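/- \textbf{Lemma (Haag's duality in time).} Let $\mu$ be a positive Borel measure on $\mathbb{R}$ of temperate growth (i.e. $\int (1+|\omega|)^{-n}\,d\mu(\omega)<\infty$ for some $n$) with $\mu((-\infty,0])=0$: the spectral measure of a generalized free field (GFF) in $0+1$ dimensions. A spectral density of $\mu$ is a measurable $\rho$, non-negative on $(0,\infty)$, with $d\mu(\omega)=\Theta(\omega)\rho(\omega^2)\,d\omega$. For real Schwartz functions $f$ let $\hat f(\omega)=\int e^{i\omega t}f(t)\,dt$, and let $|f\rangle$ be the class of $\hat f$ in the one-particle Hilbert space $\mathcal{H}_\mu=L^2(\mathbb{R},d\mu)$. Let $\mathcal{F}=\bigoplus_{n\ge 0}\mathcal{H}_\mu^{\otimes n,\mathrm{sym}}$ be the bosonic Fock space, and let $W(f)=e^{i\varphi(f)}$, $\varphi(f)=a^\dagger(|f\rangle)+a(|f\rangle)$, be the Weyl operators on $\mathcal F$, which satisfy $W(f)W(g)=e^{-i\,\mathrm{Im}\langle f|g\rangle}W(f+g)$ and $\langle\Omega|W(f)|\Omega\rangle=e^{-\frac12\langle f|f\rangle}$. For $S\subseteq\mathbb{R}$ let $\mathcal{B}_S\subseteq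 B(\mathcal{F})$ be the C$^*$-algebra generated by the $W(f)$ with $f$ real Schwartz and vanishing outside $S$. A prime on an algebra denotes its commutant in $B(\mathcal{F})$. Let $T>0$, $s\in\mathbb{R}$, $I=(s,s+T)$ and $I'=(-\infty,s)\cup(s+T,\infty)$. Suppose that the time-band algebra $\mathcal{B}_I$ satisfies timelike Haag duality, $(\mathcal{B}_I)'=\mathcal{B}_{I'}$, or, more generally, that this holds at the level of von Neumann algebras, $(\mathcal{B}_I)'=(\mathcal{B}_{I'})''$. Then $\mu$ has a spectral density $\rho$, and $\rho(\omega^2)$ is, as a function of the frequency $\omega>0$, an entire function of $\omega$ of exponential type $T$: there are an entire function $F:\mathbb{C}\to\mathbb{C}$ and a constant $C$ such that $$|F(z)|<C\,e^{T|z|}\quad\text{for all } z\in\mathbb{C},$$ and every spectral density $\rho$ of $\mu$ satisfies $\rho(\omega^2)=F(\omega)$ for almost every $\omega>0$. -/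

import Mathlib

open MeasureTheory
open scoped SchwartzMap

noncomputable section
namespace GFF

instance sigmaFinite_of_tempered (μ : Measure ℝ) [μ.HasTemperateGrowth] : SigmaFinite μ := by
  have h := μ.integrable_pow_neg_integrablePower
  refine ⟨⟨⟨fun n => Metric.closedBall 0 n, fun _ => trivial, fun n => ?_, ?_⟩⟩⟩
  · have hn : (0 : ℝ) < (1 + (n : ℝ)) ^ (-(μ.integrablePower : ℝ)) := by positivity
    refine (measure_mono fun x hx => ?_).trans_lt (h.measure_ge_lt_top hn)
    have hx' : ‖x‖ ≤ n := by simpa using hx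
    exact Real.rpow_le_rpow_of_nonpos (by positivity) (by linarith) (by simp)
  · exact Metric.iUnion_closedBall_nat 0

/-- The Fourier transform `f̂(ω) = ∫ e^{iωt} f(t) dt` in the angular frequency `ω`, with the sign for which
`f(· + s)` has transform `e^{-iωs} f̂(ω)`. -/
def angularFourier (f : 𝓢(ℝ, ℝ)) (ω : ℝ) : ℂ :=
  ∫ t : ℝ, Complex.exp (Complex.I * ω * t) * (f t : ℂ)

theorem memLp_angularFourier (μ : Measure ℝ) [μ.HasTemperateGrowth] (f : 𝓢(ℝ, ℝ)) :
    MemLp (angularFourier f) 2 μ := by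
  have hc : (-(2 * Real.pi)⁻¹ : ℝ) ≠ 0 := by simp [Real.pi_ne_zero]
  let e : ℝ ≃L[ℝ] ℝ := ContinuousLinearEquiv.unitsEquivAut ℝ (Units.mk0 _ hc)
  let g : 𝓢(ℝ, ℂ) := f.postcompCLM (𝕜 := ℝ) Complex.ofRealCLM
  let G : 𝓢(ℝ, ℂ) := SchwartzMap.compCLMOfContinuousLinearEquiv ℂ e (FourierTransform.fourier g)
  have hG : angularFourier f = G := by
    funext ω
    simp only [G, SchwartzMap.compCLMOfContinuousLinearEquiv_apply, Function.comp]
    rw [SchwartzMap.fourier_coe, Real.fourier_eq' ]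
    simp only [angularFourier]
    congr 1
    funext t
    simp [g, e]
    left
    congr 1
    field_simp
  rw [hG]
  exact G.memLp 2 μ

/-- The one-particle vector `|f⟩` of a real test function `f`: the class of `f̂` in the one-particle Hilbert
space `L²(ℝ, dμ)`, where `μ` is the spectral measure. -/
def oneParticle (μ : Measure ℝ) [μ.HasTemperateGrowth] (f : 𝓢(ℝ, ℝ)) : Lp ℂ 2 μ :=
  (memLp_angularFourier μ f).toLp

theorem measurePreserving_perm (μ : Measure ℝ) [SigmaFinite μ] (n : ℕ) (σ : Equiv.Perm (Fin n)) :
    MeasurePreserving (fun x : Fin n → ℝ => x ∘ σ)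
      (Measure.pi fun _ => μ) (Measure.pi fun _ => μ) := by
  have := measurePreserving_piCongrLeft (fun _ : Fin n => μ) σ.symm
  convert this using 1
  funext x i
  simp [MeasurableEquiv.coe_piCongrLeft, Equiv.piCongrLeft_apply]

/-- The `n`-particle space, i.e. the `n`-th symmetric Hilbert tensor power of `L²(μ)`, realised as the
wave functions in `L²(ℝⁿ, μ^{⊗n})` that are invariant under all permutations of the `n` variables
(see `mem_nParticle`). -/
def nParticle (μ : Measure ℝ) [SigmaFinite μ] (n : ℕ) :
    Submodule ℂ (Lp ℂ 2 (Measure.pi fun _ : Fin n => μ)) :=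
  ⨅ σ : Equiv.Perm (Fin n), LinearMap.eqLocus
    (Lp.compMeasurePreservingₗ ℂ (fun x : Fin n → ℝ => x ∘ σ) (measurePreserving_perm μ n σ))
    LinearMap.id

theorem mem_nParticle (μ : Measure ℝ) [SigmaFinite μ] (n : ℕ)
    (ψ : Lp ℂ 2 (Measure.pi fun _ : Fin n => μ)) :
    ψ ∈ nParticle μ n ↔ ∀ σ : Equiv.Perm (Fin n),
      (fun x => ψ (x ∘ σ)) =ᵐ[Measure.pi fun _ : Fin n => μ] ψ := by
  simp only [nParticle, Submodule.mem_iInf]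
  refine forall_congr' fun σ => ?_
  rw [LinearMap.mem_eqLocus, LinearMap.id_apply, Lp.ext_iff]
  have := Lp.coeFn_compMeasurePreserving ψ (measurePreserving_perm μ n σ)
  exact ⟨fun h => this.symm.trans h, fun h => this.trans h⟩

instance (μ : Measure ℝ) [SigmaFinite μ] (n : ℕ) : CompleteSpace (nParticle μ n) := by
  refine IsClosed.completeSpace_coe (hs := ?_)
  simp only [nParticle, Submodule.coe_iInf]
  refine isClosed_iInter fun σ => ?_
  exact isClosed_eq (Lp.isometry_compMeasurePreserving (measurePreserving_perm μ n σ)).continuous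
    continuous_id

/-- The bosonic Fock space `⨁ₙ (L²(μ))^{⊗n, sym}` (Hilbert space direct sum). -/
abbrev Fock (μ : Measure ℝ) [SigmaFinite μ] : Type := lp (fun n : ℕ => nParticle μ n) 2

theorem memLp_prod {μ : Measure ℝ} [SigmaFinite μ] (n : ℕ) (u : Fin n → Lp ℂ 2 μ) :
    MemLp (fun x : Fin n → ℝ => ∏ i, u i (x i)) 2 (Measure.pi fun _ : Fin n => μ) := by
  have hm : AEStronglyMeasurable (fun x : Fin n → ℝ => ∏ i, u i (x i))
      (Measure.pi fun _ : Fin n => μ) := by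
    refine Finset.aestronglyMeasurable_fun_prod _ fun i _ => ?_
    exact (Lp.aestronglyMeasurable (u i)).comp_quasiMeasurePreserving
      (Measure.quasiMeasurePreserving_eval (fun _ : Fin n => μ) i)
  rw [memLp_two_iff_integrable_sq_norm hm]
  simp only [norm_prod, ← Finset.prod_pow]
  exact Integrable.fintype_prod (μ := fun _ : Fin n => μ) (f := fun i t => ‖u i t‖ ^ 2)
    fun i => (memLp_two_iff_integrable_sq_norm (Lp.aestronglyMeasurable (u i))).1 (Lp.memLp (u i))

/-- The product wave function `u₁ ⊗ ⋯ ⊗ uₙ`. -/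
def tensor {μ : Measure ℝ} [SigmaFinite μ] (n : ℕ) (u : Fin n → Lp ℂ 2 μ) :
    Lp ℂ 2 (Measure.pi fun _ : Fin n => μ) := (memLp_prod n u).toLp

/-- The symmetric product wave function `u ⊗ ⋯ ⊗ u`. -/
def tensorPow {μ : Measure ℝ} [SigmaFinite μ] (n : ℕ) (u : Lp ℂ 2 μ) : nParticle μ n :=
  ⟨tensor n fun _ => u, by
    rw [mem_nParticle]
    intro σ
    have h := (memLp_prod n fun _ => u).coeFn_toLp
    have h' := (measurePreserving_perm μ n σ).quasiMeasurePreserving.ae_eq_comp h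
    refine h'.trans (Filter.EventuallyEq.trans (Filter.Eventually.of_forall fun x => ?_) h.symm)
    exact Equiv.prod_comp σ fun i => u (x i)⟩

theorem inner_tensorPow {μ : Measure ℝ} [SigmaFinite μ] (n : ℕ) (u v : Lp ℂ 2 μ) :
    inner ℂ (tensorPow n u) (tensorPow n v) = inner ℂ u v ^ n := by
  change inner ℂ (tensor n fun _ => u) (tensor n fun _ => v) = _
  rw [L2.inner_def, L2.inner_def]
  have hu := (memLp_prod n fun _ => u).coeFn_toLp
  have hv := (memLp_prod n fun _ => v).coeFn_toLp
  have : ∀ᵐ x ∂(Measure.pi fun _ : Fin n => μ),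
      inner ℂ ((tensor n fun _ => u : Lp ℂ 2 (Measure.pi fun _ : Fin n => μ)) x)
        ((tensor n fun _ => v : Lp ℂ 2 (Measure.pi fun _ : Fin n => μ)) x)
      = ∏ i, inner ℂ (u (x i)) (v (x i)) := by
    filter_upwards [hu, hv] with x h1 h2
    simp only [tensor, h1, h2]
    simp [Finset.prod_mul_distrib]
  rw [integral_congr_ae this]
  rw [integral_fintype_prod_eq_pow (μ := μ) (fun t => inner ℂ (u t) (v t))]
  simp


theorem norm_tensorPow {μ : Measure ℝ} [SigmaFinite μ] (n : ℕ) (u : Lp ℂ 2 μ) :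
    ‖tensorPow n u‖ = ‖u‖ ^ n := by
  have h := inner_tensorPow n u u
  have h0 := inner_self_eq_norm_sq_to_K (𝕜 := ℂ) (tensorPow n u)
  replace h := h0.symm.trans h
  rw [inner_self_eq_norm_sq_to_K] at h
  have h' : ‖tensorPow n u‖ ^ 2 = (‖u‖ ^ n) ^ 2 := by
    rw [← pow_mul, mul_comm n 2, pow_mul]; exact_mod_cast h
  exact (pow_left_inj₀ (norm_nonneg _) (by positivity) two_ne_zero).1 h'

/-- The exponential (unnormalised coherent) vector `e(u) = ∑ₙ u^{⊗n} / √n!`; `e(0)` is the vacuum. -/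
def expVec {μ : Measure ℝ} [SigmaFinite μ] (u : Lp ℂ 2 μ) : Fock μ :=
  ⟨fun n => ((Real.sqrt n.factorial : ℂ)⁻¹) • tensorPow n u, by
    refine memℓp_gen ?_
    have : ∀ n : ℕ, ‖((Real.sqrt n.factorial : ℂ)⁻¹) • tensorPow n u‖ ^ (2 : ENNReal).toReal
        = (‖u‖ ^ 2) ^ n / n.factorial := by
      intro n
      rw [norm_smul, norm_tensorPow]
      simp only [ENNReal.toReal_ofNat, Real.rpow_ofNat, norm_inv, Complex.norm_real,
        Real.norm_eq_abs, mul_pow, inv_pow, sq_abs]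
      rw [Real.sq_sqrt (by positivity)]
      ring
    simp only [this]
    exact Real.summable_pow_div_factorial _⟩

theorem inner_expVec {μ : Measure ℝ} [SigmaFinite μ] (u v : Lp ℂ 2 μ) :
    inner ℂ (expVec u) (expVec v) = Complex.exp (inner ℂ u v) := by
  rw [lp.inner_eq_tsum, Complex.exp_eq_exp_ℂ, NormedSpace.exp_eq_tsum_div]
  congr 1
  funext n
  change inner ℂ (((Real.sqrt n.factorial : ℂ)⁻¹) • tensorPow n u)
    (((Real.sqrt n.factorial : ℂ)⁻¹) • tensorPow n v) = _
  have h1 := inner_smul_left (𝕜 := ℂ) (tensorPow n u)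
    (((Real.sqrt n.factorial : ℂ)⁻¹) • tensorPow n v) ((Real.sqrt n.factorial : ℂ)⁻¹)
  have h2 := inner_smul_right (𝕜 := ℂ) (tensorPow n u) (tensorPow n v)
    ((Real.sqrt n.factorial : ℂ)⁻¹)
  refine h1.trans ?_
  rw [h2.trans (congrArg _ (inner_tensorPow n u v)), ← mul_assoc]
  have h : (Real.sqrt n.factorial : ℂ) * Real.sqrt n.factorial = n.factorial := by
    rw [← Complex.ofReal_mul, Real.mul_self_sqrt (by positivity)]; simp
  rw [map_inv₀, Complex.conj_ofReal, ← mul_inv, h]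
  ring

/-- The linear map from formal combinations of one-particle vectors sending `u` to `e(u)`. -/
def expMap (μ : Measure ℝ) [SigmaFinite μ] : (Lp ℂ 2 μ →₀ ℂ) →ₗ[ℂ] Fock μ :=
  Finsupp.linearCombination ℂ expVec

/-- The linear map from formal combinations of one-particle vectors that sends `u` to
`e^{i(a†(f) + a(f))} e(u) = e^{-‖f‖²/2 + i⟨f, u⟩} e(u + i f)`. -/
def weylExpMap {μ : Measure ℝ} [SigmaFinite μ] (f : Lp ℂ 2 μ) : (Lp ℂ 2 μ →₀ ℂ) →ₗ[ℂ] Fock μ :=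
  Finsupp.linearCombination ℂ fun u =>
    Complex.exp (-(‖f‖ ^ 2 / 2 : ℝ) + Complex.I * inner ℂ f u) • expVec (u + Complex.I • f)

/-- `W(f)` is isometric on the span of the exponential vectors. -/
theorem norm_weylExpMap {μ : Measure ℝ} [SigmaFinite μ] (f : Lp ℂ 2 μ) (x : Lp ℂ 2 μ →₀ ℂ) :
    ‖weylExpMap f x‖ = ‖expMap μ x‖ := by
  have key : inner ℂ (weylExpMap f x) (weylExpMap f x) = inner ℂ (expMap μ x) (expMap μ x) := by
    simp only [weylExpMap, expMap, Finsupp.linearCombination_apply, Finsupp.sum, sum_inner,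
      inner_sum]
    refine Finset.sum_congr rfl fun u _ => Finset.sum_congr rfl fun v _ => ?_
    simp only [inner_smul_left, inner_smul_right, inner_expVec]
    have hE : Complex.exp (-(‖f‖ ^ 2 / 2 : ℝ) + Complex.I * inner ℂ f u) *
        (starRingEnd ℂ) (Complex.exp (-(‖f‖ ^ 2 / 2 : ℝ) + Complex.I * inner ℂ f v)) *
        Complex.exp (inner ℂ (v + Complex.I • f) (u + Complex.I • f)) =
        Complex.exp (inner ℂ v u) := by
      rw [← Complex.exp_conj, ← Complex.exp_add, ← Complex.exp_add]
      congr 1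
      simp only [inner_add_left, inner_add_right, inner_smul_left, inner_smul_right, map_add,
        map_neg, map_mul, Complex.conj_ofReal, Complex.conj_I, inner_conj_symm,
        inner_self_eq_norm_sq_to_K]
      push_cast
      linear_combination (-(‖f‖ : ℂ) ^ 2) * Complex.I_sq
    linear_combination (x u * (starRingEnd ℂ) (x v)) * hE
  rw [inner_self_eq_norm_sq_to_K, inner_self_eq_norm_sq_to_K] at key
  have h' : ‖weylExpMap f x‖ ^ 2 = ‖expMap μ x‖ ^ 2 := by exact_mod_cast key
  exact (pow_left_inj₀ (norm_nonneg _) (norm_nonneg _) two_ne_zero).1 h'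

theorem tensor_indicator {μ : Measure ℝ} [SigmaFinite μ] (n : ℕ)
    (ψ : Lp ℂ 2 (Measure.pi fun _ : Fin n => μ)) (A : Fin n → Set ℝ)
    (hA : ∀ i, MeasurableSet (A i)) (hμ : ∀ i, μ (A i) ≠ ⊤) :
    inner ℂ (tensor n fun i => indicatorConstLp 2 (hA i) (hμ i) (1 : ℂ)) ψ
      = ∫ x in Set.univ.pi A, ψ x ∂(Measure.pi fun _ : Fin n => μ) := by
  have hi : ∀ᵐ x ∂(Measure.pi fun _ : Fin n => μ), ∀ i,
      indicatorConstLp 2 (hA i) (hμ i) (1 : ℂ) (x i) = (A i).indicator (fun _ => 1) (x i) := by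
    rw [ae_all_iff]
    intro i
    exact (Measure.quasiMeasurePreserving_eval (fun _ : Fin n => μ) i).ae_eq_comp
      (indicatorConstLp_coeFn (hs := hA i) (hμs := hμ i) (c := (1 : ℂ)))
  rw [L2.inner_def, ← integral_indicator (MeasurableSet.univ_pi hA)]
  refine integral_congr_ae ?_
  filter_upwards [hi, (memLp_prod n
    fun i => indicatorConstLp 2 (hA i) (hμ i) (1 : ℂ)).coeFn_toLp] with x h1 h2
  simp only [tensor, h2]
  simp only [h1]
  by_cases hx : x ∈ Set.univ.pi A
  · have : ∀ i, x i ∈ A i := fun i => hx i trivial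
    simp [hx, this]
  · obtain ⟨i, hi⟩ : ∃ i, x i ∉ A i := by
      by_contra hcon
      push Not at hcon
      exact hx fun i _ => hcon i
    rw [Finset.prod_eq_zero (Finset.mem_univ i) (by simp [hi])]
    simp [hx]

theorem eq_zero_of_boxes {μ : Measure ℝ} [SigmaFinite μ] (n : ℕ)
    (ψ : Lp ℂ 2 (Measure.pi fun _ : Fin n => μ))
    (h : ∀ A : Fin n → Set ℝ, (∀ i, MeasurableSet (A i)) → (∀ i, μ (A i) ≠ ⊤) →
      ∫ x in Set.univ.pi A, ψ x ∂(Measure.pi fun _ : Fin n => μ) = 0) : ψ = 0 := by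
  let ν := Measure.pi fun _ : Fin n => μ
  let B : ℕ → Set (Fin n → ℝ) := fun k => Set.univ.pi fun _ => spanningSets μ k
  have hBm : ∀ k, MeasurableSet (B k) := fun k =>
    MeasurableSet.univ_pi fun _ => measurableSet_spanningSets μ k
  have hBfin : ∀ k, ν (B k) ≠ ⊤ := by
    intro k
    simp only [ν, B, Measure.pi_pi]
    exact ENNReal.prod_ne_top fun i _ => (measure_spanningSets_lt_top μ k).ne
  have hint : ∀ k, IntegrableOn ψ (B k) ν := by
    intro k
    exact integrableOn_Lp_of_measure_ne_top ψ (by norm_num) (hBfin k)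
  have hzero : ∀ k (s : Set (Fin n → ℝ)), MeasurableSet s →
      ∫ x in s, ψ x ∂(ν.restrict (B k)) = 0 := by
    intro k
    have hint' : Integrable ψ (ν.restrict (B k)) := hint k
    have huniv : ∫ x, ψ x ∂(ν.restrict (B k)) = 0 :=
      h (fun _ => spanningSets μ k) (fun _ => measurableSet_spanningSets μ k)
        fun _ => (measure_spanningSets_lt_top μ k).ne
    refine fun s hs => MeasurableSpace.induction_on_inter
      (C := fun s _ => ∫ x in s, ψ x ∂(ν.restrict (B k)) = 0)
      generateFrom_pi.symm isPiSystem_pi ?_ ?_ ?_ ?_ s hs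
    · simp
    · rintro t ⟨A, hA, rfl⟩
      have hA' : ∀ i, MeasurableSet (A i) := fun i => hA i trivial
      rw [Measure.restrict_restrict (MeasurableSet.univ_pi hA')]
      simp only [B, ← Set.pi_inter_distrib]
      exact h _ (fun i => (hA' i).inter (measurableSet_spanningSets μ k)) fun i =>
        ((measure_mono Set.inter_subset_right).trans_lt (measure_spanningSets_lt_top μ k)).ne
    · intro t ht h0
      have := integral_add_compl ht hint'
      rw [huniv, h0, zero_add] at this
      exact this
    · intro f hd hm h0
      rw [integral_iUnion hm hd hint'.integrableOn]
      simp [h0]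
  have hk : ∀ k, ∀ᵐ x ∂ν, x ∈ B k → ψ x = 0 := by
    intro k
    rw [← ae_restrict_iff' (hBm k)]
    exact Integrable.ae_eq_zero_of_forall_setIntegral_eq_zero (hint k) fun s hs _ => hzero k s hs
  rw [Lp.eq_zero_iff_ae_eq_zero]
  filter_upwards [ae_all_iff.2 hk] with x hx
  have hmono := monotone_spanningSets μ
  have : ∃ k, x ∈ B k := by
    have hex : ∀ i, ∃ k, x i ∈ spanningSets μ k := fun i => by
      have := Set.mem_univ (x i)
      rw [← iUnion_spanningSets μ] at this
      exact Set.mem_iUnion.1 this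
    choose K hK using hex
    refine ⟨Finset.univ.sup K, fun i _ => ?_⟩
    exact hmono (Finset.le_sup (Finset.mem_univ i)) (hK i)
  obtain ⟨k, hk⟩ := this
  exact hx k hk

theorem coeFn_sum_smul {α : Type*} [MeasurableSpace α] {μ : Measure α} {ι : Type*} (s : Finset ι) (t : ι → ℂ)
    (v : ι → Lp ℂ 2 μ) :
    (∑ i ∈ s, t i • v i : Lp ℂ 2 μ) =ᵐ[μ] fun y => ∑ i ∈ s, t i * v i y := by
  classical
  induction s using Finset.induction_on with
  | empty => simpa using! Lp.coeFn_zero ℂ 2 μ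
  | insert a s ha ih =>
    rw [Finset.sum_insert ha]
    filter_upwards [ih, Lp.coeFn_add (t a • v a) (∑ i ∈ s, t i • v i),
      Lp.coeFn_smul (t a) (v a)] with y h1 h2 h3
    rw [h2, Pi.add_apply, h1, h3, Finset.sum_insert ha]
    simp

theorem tensor_sum {μ : Measure ℝ} [SigmaFinite μ] {ι : Type*} [Fintype ι] (n : ℕ) (t : ι → ℂ)
    (v : ι → Lp ℂ 2 μ) :
    (tensor n fun _ => ∑ i, t i • v i) =
      ∑ φ : Fin n → ι, (∏ j, t (φ j)) • tensor n fun j => v (φ j) := by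
  classical
  rw [Lp.ext_iff]
  refine Filter.EventuallyEq.trans ?_ (coeFn_sum_smul _ _ _).symm
  have h1 := (memLp_prod n fun _ => ∑ i, t i • v i).coeFn_toLp
  have h2 : ∀ᵐ x ∂(Measure.pi fun _ : Fin n => μ), ∀ φ : Fin n → ι,
      (tensor n fun j => v (φ j) : Lp ℂ 2 (Measure.pi fun _ : Fin n => μ)) x
        = ∏ j, v (φ j) (x j) :=
    ae_all_iff.2 fun φ => (memLp_prod n fun j => v (φ j)).coeFn_toLp
  have h3 : ∀ᵐ x ∂(Measure.pi fun _ : Fin n => μ), ∀ j : Fin n,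
      (∑ i, t i • v i : Lp ℂ 2 μ) (x j) = ∑ i, t i * v i (x j) :=
    ae_all_iff.2 fun j => (Measure.quasiMeasurePreserving_eval (fun _ : Fin n => μ) j).ae_eq_comp
      (coeFn_sum_smul Finset.univ t v)
  filter_upwards [h1, h2, h3] with x h1 h2 h3
  have h1' : (tensor n fun _ => ∑ i, t i • v i : Lp ℂ 2 (Measure.pi fun _ : Fin n => μ)) x = _ := h1
  rw [h1']
  simp only [h2, h3, ← Finset.prod_mul_distrib]
  rw [Finset.prod_univ_sum]
  simp

/-- Polarisation: a symmetric wave function orthogonal to all `u ⊗ ⋯ ⊗ u` is orthogonal to all products. -/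
theorem inner_tensor_eq_zero {μ : Measure ℝ} [SigmaFinite μ] (n : ℕ) (ψ : nParticle μ n)
    (h : ∀ u : Lp ℂ 2 μ, inner ℂ (tensorPow n u) ψ = 0) (v : Fin n → Lp ℂ 2 μ) :
    inner ℂ (tensor n v) (ψ : Lp ℂ 2 (Measure.pi fun _ : Fin n => μ)) = 0 := by
  classical
  have hsymm : ∀ σ : Equiv.Perm (Fin n),
      inner ℂ (tensor n (v ∘ σ)) (ψ : Lp ℂ 2 (Measure.pi fun _ : Fin n => μ))
        = inner ℂ (tensor n v) (ψ : Lp ℂ 2 (Measure.pi fun _ : Fin n => μ)) := by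
    intro σ
    have hψ := (mem_nParticle μ n ψ).1 ψ.2 σ
    rw [L2.inner_def, L2.inner_def]
    have hmp := measurePreserving_perm μ n σ
    have e1 := (memLp_prod n (v ∘ σ)).coeFn_toLp
    have e2 := (memLp_prod n v).coeFn_toLp
    have e1' := hmp.quasiMeasurePreserving.ae_eq_comp e1
    have hemb : MeasurableEmbedding (fun x : Fin n → ℝ => x ∘ σ) := by
      have := (MeasurableEquiv.piCongrLeft (fun _ : Fin n => ℝ) σ.symm).measurableEmbedding
      convert this using 1
      funext x i
      simp [MeasurableEquiv.coe_piCongrLeft, Equiv.piCongrLeft_apply]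
    rw [← hmp.integral_comp hemb]
    refine integral_congr_ae ?_
    filter_upwards [hψ, e1', e2] with x h1 h2 h3
    have h4 : tensor n (v ∘ σ) (x ∘ σ) = ∏ i, v i (x i) :=
      h2.trans (Equiv.prod_comp σ fun i => v i (x i))
    have h5 : tensor n v x = ∏ i, v i (x i) := h3
    simp only [h1, h4, h5]
  let c : (Fin n → Fin n) → ℂ := fun φ =>
    inner ℂ (tensor n (v ∘ φ)) (ψ : Lp ℂ 2 (Measure.pi fun _ : Fin n => μ))
  have hpoly : ∀ t : Fin n → ℂ, ∑ φ : Fin n → Fin n, (∏ j, t (φ j)) * c φ = 0 := by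
    intro t
    have h1 : inner ℂ (tensor n fun _ => ∑ i, (starRingEnd ℂ (t i)) • v i)
      (ψ : Lp ℂ 2 (Measure.pi fun _ : Fin n => μ)) = 0 := h _
    rw [tensor_sum, sum_inner] at h1
    rw [← h1]
    refine Finset.sum_congr rfl fun φ _ => ?_
    simp [inner_smul_left, c, Function.comp_def]
  let p : MvPolynomial (Fin n) ℂ :=
    ∑ φ : Fin n → Fin n, MvPolynomial.monomial (∑ j, Finsupp.single (φ j) 1) (c φ)
  have hp : p = 0 := by
    refine MvPolynomial.funext fun t => ?_
    simp only [p, map_sum, MvPolynomial.eval_monomial, map_zero]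
    rw [← hpoly t]
    refine Finset.sum_congr rfl fun φ _ => ?_
    rw [← Finsupp.prod_finsetSum_index (by simp) (by intros; rw [pow_add])]
    simp [mul_comm]
  have hcoef := congrArg (MvPolynomial.coeff (∑ j, Finsupp.single j 1)) hp
  simp only [p, MvPolynomial.coeff_sum, MvPolynomial.coeff_monomial, MvPolynomial.coeff_zero]
    at hcoef
  have hone : ∀ φ : Fin n → Fin n,
      (∑ j, Finsupp.single (φ j) 1 : Fin n →₀ ℕ) = ∑ j, Finsupp.single j 1 → c φ = c id := by
    intro φ hφ
    have hsurj : Function.Surjective φ := by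
      intro i
      by_contra hcon
      push Not at hcon
      have := DFunLike.congr_fun hφ i
      simp [Finsupp.finsetSum_apply, Finsupp.single_apply, hcon] at this
    exact hsymm (Equiv.ofBijective φ (Finite.injective_iff_bijective.1
      (Finite.injective_iff_surjective.2 hsurj)))
  have hsum : ∀ φ : Fin n → Fin n,
      (if (∑ j, Finsupp.single (φ j) 1 : Fin n →₀ ℕ) = ∑ j, Finsupp.single j 1 then c φ else 0)
      = (if (∑ j, Finsupp.single (φ j) 1 : Fin n →₀ ℕ) = ∑ j, Finsupp.single j 1 then 1 else 0)
        * c id := by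
    intro φ
    split_ifs with hφ
    · rw [hone φ hφ, one_mul]
    · simp
  simp only [hsum] at hcoef
  rw [← Finset.sum_mul, Finset.sum_boole] at hcoef
  rcases mul_eq_zero.1 hcoef with h0 | h0
  · exfalso
    rw [Nat.cast_eq_zero, Finset.card_eq_zero] at h0
    have : (id : Fin n → Fin n) ∈ (∅ : Finset (Fin n → Fin n)) := by
      rw [← h0]; simp
    simp at this
  · exact h0

/-- The exponential vectors span a dense subspace of Fock space. -/
theorem denseRange_expMap (μ : Measure ℝ) [SigmaFinite μ] : DenseRange (expMap μ) := by
  suffices hs : (LinearMap.range (expMap μ)).topologicalClosure = ⊤ by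
    intro x
    have : x ∈ (LinearMap.range (expMap μ)).topologicalClosure := hs ▸ Submodule.mem_top
    simpa using! this
  rw [Submodule.topologicalClosure_eq_top_iff, Submodule.eq_bot_iff]
  intro ψ hψ
  have hexp : ∀ u, inner ℂ (expVec u) ψ = 0 := fun u =>
    (Submodule.mem_orthogonal _ _).1 hψ _ ⟨Finsupp.single u 1, by simp [expMap]⟩
  have hpow : ∀ n (u : Lp ℂ 2 μ), inner ℂ (tensorPow n u) (ψ n) = 0 := by
    intro n u
    let a : ℕ → ℂ := fun n => inner ℂ (((Real.sqrt n.factorial : ℂ)⁻¹) • tensorPow n u) (ψ n)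
    have ht : ∀ t : ℂ, HasSum (fun n => a n * t ^ n) 0 := by
      intro t
      have h := lp.hasSum_inner (𝕜 := ℂ) (expVec ((starRingEnd ℂ t) • u)) ψ
      rw [hexp] at h
      refine Eq.mp (congrArg (fun F : ℕ → ℂ => HasSum F 0) (funext fun m => ?_)) h
      symm
      have hm : tensorPow m ((starRingEnd ℂ t) • u) = (starRingEnd ℂ t) ^ m • tensorPow m u := by
        refine Subtype.ext ?_
        have := tensor_sum (ι := Unit) m (fun _ => starRingEnd ℂ t) (fun _ => u)
        simpa using! this
      change a m * t ^ m = inner ℂ (((Real.sqrt m.factorial : ℂ)⁻¹) •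
        tensorPow m ((starRingEnd ℂ t) • u)) (ψ m)
      rw [hm, smul_comm]
      have h9 := inner_smul_left (𝕜 := ℂ) (((Real.sqrt m.factorial : ℂ)⁻¹) • tensorPow m u) (ψ m)
        ((starRingEnd ℂ t) ^ m)
      refine Eq.trans ?_ h9.symm
      rw [map_pow, Complex.conj_conj, mul_comm]
    let p := FormalMultilinearSeries.ofScalars ℂ a
    have hr : 0 < p.radius := by
      obtain ⟨C, hC⟩ := (ht 1).summable.tendsto_atTop_zero.norm.bddAbove_range
      have h1 := p.le_radius_of_bound (r := 1) C fun n => by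
        have := hC ⟨n, rfl⟩
        simpa [p, FormalMultilinearSeries.ofScalars_norm] using this
      exact lt_of_lt_of_le (by simp) h1
    have hp0 : HasFPowerSeriesAt (0 : ℂ → ℂ) p 0 := by
      have h1 := (p.hasFPowerSeriesOnBall hr).hasFPowerSeriesAt
      have h2 : p.sum = 0 := by
        funext t
        have := FormalMultilinearSeries.ofScalars_sum_eq a t
        refine Eq.trans this ?_
        simpa using (ht t).tsum_eq
      rwa [h2] at h1
    have ha : a n = 0 := by
      have h1 := hp0.eq_zero
      have h2 : ‖p n‖ = ‖a n‖ := FormalMultilinearSeries.ofScalars_norm ℂ a n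
      rw [h1] at h2
      simpa using h2.symm
    have h3 := (inner_smul_left (𝕜 := ℂ) (tensorPow n u) (ψ n)
      ((Real.sqrt n.factorial : ℂ)⁻¹)).symm.trans ha
    have hf : (Real.sqrt n.factorial) ≠ 0 := by positivity
    refine (mul_eq_zero.1 h3).resolve_left ?_
    simpa using hf
  refine lp.ext (funext fun n => Subtype.ext ?_)
  refine eq_zero_of_boxes n _ fun A hA hμ => ?_
  rw [← tensor_indicator n _ A hA hμ]
  exact inner_tensor_eq_zero n (ψ n) (hpow n) _

/-- The Weyl operator `W(f) = e^{iφ(f)}`, `φ(f) = a†(f) + a(f)`, on Fock space: the continuous extension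
of its action on exponential vectors (see `weyl_expVec`). It is unitary and satisfies
`W(f) W(g) = e^{-i Im ⟨f, g⟩} W(f + g)` and `⟨Ω, W(f) Ω⟩ = e^{-‖f‖²/2}`. -/
def weyl {μ : Measure ℝ} [SigmaFinite μ] (f : Lp ℂ 2 μ) : Fock μ →L[ℂ] Fock μ :=
  (weylExpMap f).extendOfNorm (expMap μ)

theorem weyl_expVec {μ : Measure ℝ} [SigmaFinite μ] (f u : Lp ℂ 2 μ) :
    weyl f (expVec u) =
      Complex.exp (-(‖f‖ ^ 2 / 2 : ℝ) + Complex.I * inner ℂ f u) • expVec (u + Complex.I • f) := by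
  have h := LinearMap.extendOfNorm_eq (f := weylExpMap f) (denseRange_expMap μ)
    ⟨1, fun x => by rw [norm_weylExpMap, one_mul]⟩ (Finsupp.single u 1)
  simpa [weyl, expMap, weylExpMap] using! h

/-- The C*-algebra of operators on a Hilbert space generated by a set of bounded operators (norm closure
of the unital *-algebra it generates). -/
def cstarAlgebraGenerated {H : Type*} [NormedAddCommGroup H] [InnerProductSpace ℂ H]
    [CompleteSpace H] (S : Set (H →L[ℂ] H)) : StarSubalgebra ℂ (H →L[ℂ] H) :=
  (StarAlgebra.adjoin ℂ S).topologicalClosure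

/-- The commutant in the bounded operators. -/
def commutant {H : Type*} [NormedAddCommGroup H] [InnerProductSpace ℂ H]
    (B : Set (H →L[ℂ] H)) : Set (H →L[ℂ] H) := {a | ∀ b ∈ B, a * b = b * a}

/-- The algebra `𝓑_S` of a set `S` of times: the C*-algebra on Fock space generated by the Weyl operators
of the real Schwartz functions supported in `S`. -/
def timeAlgebra (μ : Measure ℝ) [μ.HasTemperateGrowth] (S : Set ℝ) :
    StarSubalgebra ℂ (Fock μ →L[ℂ] Fock μ) :=
  cstarAlgebraGenerated
    {W | ∃ f : 𝓢(ℝ, ℝ), Function.support f ⊆ S ∧ W = weyl (oneParticle μ f)}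

/-- Haag's duality in time, `(𝓑_I)' = 𝓑_{I'}`, for `I = (s, s + T)` and
`I' = (-∞, s) ∪ (s + T, ∞)`, as an equality with the C*-algebra `𝓑_{I'}` itself. -/
def HaagDuality (μ : Measure ℝ) [μ.HasTemperateGrowth] (s T : ℝ) : Prop :=
  commutant (timeAlgebra μ (Set.Ioo s (s + T)) : Set (Fock μ →L[ℂ] Fock μ)) =
    timeAlgebra μ (Set.Iio s ∪ Set.Ioi (s + T))

/-- Haag's duality in time on the level of von Neumann algebras, `(𝓑_I)' = (𝓑_{I'})''`. This is implied by
`HaagDuality`, as `(𝓑_I)'` is a von Neumann algebra. -/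
def HaagDualityVN (μ : Measure ℝ) [μ.HasTemperateGrowth] (s T : ℝ) : Prop :=
  commutant (timeAlgebra μ (Set.Ioo s (s + T)) : Set (Fock μ →L[ℂ] Fock μ)) =
    commutant (commutant (timeAlgebra μ (Set.Iio s ∪ Set.Ioi (s + T)) :
      Set (Fock μ →L[ℂ] Fock μ)))

/-- `ρ` is the spectral density of the spectral measure `μ`: `dμ(ω) = Θ(ω) ρ(ω²) dω`. -/
def IsSpectralDensity (μ : Measure ℝ) (ρ : ℝ → ℝ) : Prop :=
  Measurable ρ ∧ (∀ x, 0 < x → 0 ≤ ρ x) ∧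
    μ = (volume.restrict (Set.Ioi (0 : ℝ))).withDensity fun ω => ENNReal.ofReal (ρ (ω ^ 2))

end GFF

end

noncomputable section

namespace GFF

open Filter Topology ComplexConjugate

/-! The density turns out to be a polynomial in `ω`, which is of exponential type `T` for every `T >
0`.

Duality makes the Weyl operators of `I` and `I'` commute, so by the Weyl relations `Im ⟨f|g⟩ = 0`
for `f` supported in `I` and `g` in `I'` (`inner_im_eq_zero_of_duality`). This form depends only on
time differences. Since `I` and `I'` have common endpoints, every nonzero time difference is
realised by a point of `I` close to an endpoint and a point of `I'` beyond it. Letting `f` shrink to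
a delta function at such a point shows that the commutator distribution `G ↦ ∫ (Ĝ(ω) - Ĝ(-ω)) dμ(ω)`
is supported at the origin (`commutatorCLM_eq_zero`).

A tempered distribution supported at a point is a finite sum of derivatives of the delta function
(`exists_eq_sum_derivAtZero`). The commutator distribution is the Fourier transform of the odd
extension of `μ`, so that extension is a polynomial in the sense of distributions, and hence `μ` has
a polynomial density on `(0, ∞)` (`exists_polynomial_density`,
`restrict_eq_withDensity_of_integral_eq`). -/

/-! ### Locality of the symplectic form -/

theorem expVec_ne_zero {μ : Measure ℝ} [SigmaFinite μ] (u : Lp ℂ 2 μ) : expVec u ≠ 0 := by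
  intro h
  have h1 := inner_expVec u u
  rw [h, inner_zero_left] at h1
  exact Complex.exp_ne_zero _ h1.symm

/-- Commuting Weyl operators: `e^{⟨f,g⟩} = e^{⟨g,f⟩}`. -/
theorem exp_inner_eq_of_weyl_commute {μ : Measure ℝ} [SigmaFinite μ] {f g : Lp ℂ 2 μ}
    (h : weyl f * weyl g = weyl g * weyl f) :
    Complex.exp (-inner ℂ f g) = Complex.exp (-inner ℂ g f) := by
  -- On the vacuum `e(0)` both products give a multiple of the same nonzero vector `e(if + ig)`, so
  -- the scalars can be compared.
  have h1 := congrArg (fun A : Fock μ →L[ℂ] Fock μ => A (expVec 0)) h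
  simp only [mul_apply_eq_comp, weyl_expVec, map_smul, inner_zero_right, mul_zero,
    add_zero, zero_add, smul_smul, inner_smul_right, ← Complex.exp_add] at h1
  rw [add_comm (Complex.I • g)] at h1
  have h2 := smul_left_injective ℂ (expVec_ne_zero (Complex.I • f + Complex.I • g)) h1
  simp only [← mul_assoc, Complex.I_mul_I, neg_mul, one_mul] at h2
  have h3 := congrArg
    (fun x => x * Complex.exp ((‖f‖ ^ 2 / 2 : ℝ) + (‖g‖ ^ 2 / 2 : ℝ))) h2
  simp only [← Complex.exp_add] at h3
  convert h3 using 2 <;> push_cast <;> ring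

theorem oneParticle_smul (μ : Measure ℝ) [μ.HasTemperateGrowth] (c : ℝ) (f : 𝓢(ℝ, ℝ)) :
    oneParticle μ (c • f) = (c : ℂ) • oneParticle μ f := by
  rw [oneParticle, oneParticle, ← MemLp.toLp_const_smul]
  congr 1
  funext ω
  simp only [angularFourier, Pi.smul_apply, smul_eq_mul, ← integral_const_mul]
  congr 1
  funext t
  simp
  ring

theorem subset_cstarAlgebraGenerated {H : Type*} [NormedAddCommGroup H] [InnerProductSpace ℂ H]
    [CompleteSpace H] (S : Set (H →L[ℂ] H)) : S ⊆ cstarAlgebraGenerated S :=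
  (StarAlgebra.subset_adjoin ℂ S).trans (StarSubalgebra.le_topologicalClosure _)

theorem weyl_mem_timeAlgebra (μ : Measure ℝ) [μ.HasTemperateGrowth] {S : Set ℝ} {f : 𝓢(ℝ, ℝ)}
    (hf : Function.support f ⊆ S) : weyl (oneParticle μ f) ∈ timeAlgebra μ S :=
  subset_cstarAlgebraGenerated _ ⟨f, hf, rfl⟩

/-- Duality implies locality: the symplectic form vanishes between `I` and `I'`. -/
theorem inner_im_eq_zero_of_duality (μ : Measure ℝ) [μ.HasTemperateGrowth] (s T : ℝ)
    (h : HaagDuality μ s T ∨ HaagDualityVN μ s T) (f g : 𝓢(ℝ, ℝ))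
    (hf : Function.support f ⊆ Set.Ioo s (s + T))
    (hg : Function.support g ⊆ Set.Iio s ∪ Set.Ioi (s + T)) :
    (inner ℂ (oneParticle μ f) (oneParticle μ g)).im = 0 := by
  have key : ∀ c : ℝ, Complex.exp (-(c * inner ℂ (oneParticle μ f) (oneParticle μ g))) =
      Complex.exp (-(c * inner ℂ (oneParticle μ g) (oneParticle μ f))) := by
    intro c
    have hcg : Function.support (c • g) ⊆ Set.Iio s ∪ Set.Ioi (s + T) :=
      (Function.support_const_smul_subset c g).trans hg
    have hW : weyl (oneParticle μ (c • g)) ∈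
        commutant (timeAlgebra μ (Set.Ioo s (s + T)) : Set (Fock μ →L[ℂ] Fock μ)) := by
      rcases h with h | h <;> rw [h]
      · exact weyl_mem_timeAlgebra μ hcg
      -- An algebra is contained in its bicommutant.
      · exact fun b hb => (hb _ (weyl_mem_timeAlgebra μ hcg)).symm
    have h1 := exp_inner_eq_of_weyl_commute (hW _ (weyl_mem_timeAlgebra μ hf))
    rw [oneParticle_smul, inner_smul_right, inner_smul_left, Complex.conj_ofReal] at h1
    exact h1.symm
  by_contra hx
  set z : ℂ := inner ℂ (oneParticle μ f) (oneParticle μ g) with hz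
  have hz' : inner ℂ (oneParticle μ g) (oneParticle μ f) = conj z := (inner_conj_symm _ _).symm
  -- Commutation for a single pair gives only `Im z ∈ πℤ`. Rescaling `g` by a real factor removes
  -- the ambiguity: this factor turns the phase into `e^{iπ} = -1`.
  have h1 := key (Real.pi / (2 * z.im))
  rw [hz'] at h1
  have h2 : Complex.exp (Real.pi * Complex.I) = 1 := by
    have h3 : (Real.pi * Complex.I : ℂ) = -(((Real.pi / (2 * z.im) : ℝ) : ℂ) * conj z)
        - -(((Real.pi / (2 * z.im) : ℝ) : ℂ) * z) := by
      have hc : z - conj z = (2 * z.im : ℝ) * Complex.I := by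
        rw [Complex.sub_conj]
      have hr : ((Real.pi / (2 * z.im) : ℝ) : ℂ) * ((2 * z.im : ℝ) : ℂ) = Real.pi := by
        rw [← Complex.ofReal_mul, div_mul_cancel₀]
        exact mul_ne_zero two_ne_zero hx
      linear_combination (-((Real.pi / (2 * z.im) : ℝ) : ℂ)) * hc - Complex.I * hr
    rw [h3, Complex.exp_sub, h1, div_self (Complex.exp_ne_zero _)]
  rw [Complex.exp_pi_mul_I] at h2
  norm_num at h2

/-! ### The Fourier transform in angular frequency -/

theorem inner_oneParticle (μ : Measure ℝ) [μ.HasTemperateGrowth] (f g : 𝓢(ℝ, ℝ)) :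
    inner ℂ (oneParticle μ f) (oneParticle μ g) =
      ∫ ω, conj (angularFourier f ω) * angularFourier g ω ∂μ := by
  rw [L2.inner_def]
  refine integral_congr_ae ?_
  filter_upwards [(memLp_angularFourier μ f).coeFn_toLp, (memLp_angularFourier μ g).coeFn_toLp]
    with ω h1 h2
  simp only [oneParticle, h1, h2]
  simp [mul_comm]

/-- The rescaling `x ↦ -x / 2π` between angular frequency and Mathlib's frequency. -/
def angularScale : ℝ ≃L[ℝ] ℝ :=
  ContinuousLinearEquiv.unitsEquivAut ℝ (Units.mk0 (-(2 * Real.pi)⁻¹ : ℝ) (by simp [Real.pi_ne_zero]))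

theorem angularScale_apply (x : ℝ) : angularScale x = -(2 * Real.pi)⁻¹ * x := by
  simp [angularScale, mul_comm]

/-- The complexification of a real Schwartz function. -/
def complexify : 𝓢(ℝ, ℝ) →L[ℝ] 𝓢(ℝ, ℂ) := SchwartzMap.postcompCLM (𝕜 := ℝ) Complex.ofRealCLM

/-- The Fourier transform with kernel `e^{iωt}` on complex Schwartz functions. -/
def angularFourierCLM : 𝓢(ℝ, ℂ) →L[ℂ] 𝓢(ℝ, ℂ) :=
  (SchwartzMap.compCLMOfContinuousLinearEquiv ℂ angularScale).comp
    (FourierTransform.fourierCLM ℂ 𝓢(ℝ, ℂ))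

theorem angularFourierCLM_apply (f : 𝓢(ℝ, ℂ)) (ω : ℝ) :
    angularFourierCLM f ω = (FourierTransform.fourier f) (angularScale ω) := rfl

theorem angularFourier_eq (f : 𝓢(ℝ, ℝ)) (ω : ℝ) :
    angularFourier f ω = angularFourierCLM (complexify f) ω := by
  rw [angularFourierCLM_apply, SchwartzMap.fourier_coe, Real.fourier_eq', angularFourier]
  congr 1
  funext t
  simp [complexify, angularScale_apply]
  left
  congr 1
  field_simp

theorem norm_angularFourier_le (f : 𝓢(ℝ, ℝ)) (ω : ℝ) : ‖angularFourier f ω‖ ≤ ∫ t, |f t| := by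
  refine (norm_integral_le_integral_norm _).trans (le_of_eq ?_)
  congr 1
  funext t
  have : Complex.I * ω * t = (ω * t : ℝ) * Complex.I := by push_cast; ring
  rw [norm_mul, this, Complex.norm_exp_ofReal_mul_I]
  simp

theorem angularFourier_translate (g h : 𝓢(ℝ, ℝ)) (a : ℝ) (hgh : ∀ t, g t = h (t - a)) (ω : ℝ) :
    angularFourier g ω = Complex.exp (Complex.I * ω * a) * angularFourier h ω := by
  simp only [angularFourier, hgh, ← integral_const_mul]
  rw [← integral_sub_right_eq_self (fun t => _ * (_ * _)) a]
  congr 1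
  funext t
  rw [← mul_assoc, ← Complex.exp_add]
  congr 2
  push_cast
  ring

theorem angularFourier_neg (f : 𝓢(ℝ, ℝ)) (ω : ℝ) :
    angularFourier f (-ω) = conj (angularFourier f ω) := by
  simp only [angularFourier]
  rw [← integral_conj]
  congr 1
  funext t
  simp [← Complex.exp_conj]

/-! ### Reduction to a single time variable -/

/-- Normalised bump functions concentrating at zero, with Fourier transforms bounded by one. -/
theorem exists_approx_delta : ∃ f : ℕ → 𝓢(ℝ, ℝ),
    (∀ n : ℕ, Function.support (f n) ⊆ Metric.ball 0 (1 / ((n : ℝ) + 1))) ∧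
    (∀ n ω, ‖angularFourier (f n) ω‖ ≤ 1) ∧
    ∀ ω, Tendsto (fun n => angularFourier (f n) ω) atTop (𝓝 1) := by
  let φ : ℕ → ContDiffBump (0 : ℝ) := fun n =>
    ⟨1 / ((n : ℝ) + 1) / 2, 1 / ((n : ℝ) + 1), by positivity, half_lt_self (by positivity)⟩
  have hφ : Tendsto (fun n => (φ n).rOut) atTop (𝓝 0) := tendsto_one_div_add_atTop_nhds_zero_nat
  let f : ℕ → 𝓢(ℝ, ℝ) := fun n =>
    ((φ n).hasCompactSupport_normed (μ := volume)).toSchwartzMap (φ n).contDiff_normed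
  have hf : ∀ n t, f n t = (φ n).normed volume t := fun n t => rfl
  refine ⟨f, fun n => ?_, fun n ω => ?_, fun ω => ?_⟩
  · exact ((φ n).support_normed_eq (μ := volume)).subset
  · refine (norm_angularFourier_le _ _).trans (le_of_eq ?_)
    rw [← (φ n).integral_normed (μ := volume)]
    congr 1
    funext t
    rw [hf, abs_of_nonneg ((φ n).nonneg_normed t)]
  -- The transform at `ω` is the value at `0` of the convolution of the bump with `t ↦ e^{-iωt}`.
  · have hc : Continuous fun t : ℝ => Complex.exp (-(Complex.I * ω * t)) := by fun_prop
    have := ContDiffBump.convolution_tendsto_right_of_continuous (μ := volume) hφ hc 0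
    simp only [Complex.ofReal_zero, mul_zero, neg_zero, Complex.exp_zero] at this
    refine this.congr fun n => ?_
    simp only [convolution, angularFourier]
    congr 1
    funext t
    simp [hf, mul_comm]

/-- The commutator function is local at coinciding times: `Im ∫ ĥ dμ = 0` for real `h` supported in
`t > a` or in `t < -a`, where `a > 0`. -/
theorem integral_im_eq_zero_of_duality (μ : Measure ℝ) [μ.HasTemperateGrowth] (s T : ℝ) (hT : 0 < T)
    (hd : HaagDuality μ s T ∨ HaagDualityVN μ s T) {a : ℝ} (ha : 0 < a) (h : 𝓢(ℝ, ℝ))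
    (hh : (∀ t ≤ a, h t = 0) ∨ ∀ t, -a ≤ t → h t = 0) :
    (∫ ω, angularFourier h ω ∂μ).im = 0 := by
  obtain ⟨f, hfs, hfb, hft⟩ := exists_approx_delta
  -- The base point is chosen in `I` at distance less than `a` from the endpoint towards which `h`
  -- is supported, so the translate of `h` by `t₀` lives in `I'`. Half of `min a T` also keeps `t₀`
  -- inside `I`.
  obtain ⟨t₀, ht₀, hsupp⟩ : ∃ t₀ ∈ Set.Ioo s (s + T), ∀ t, h (t - t₀) ≠ 0 → t < s ∨ s + T < t := by
    have hm : 0 < min a T / 2 := by positivity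
    have hma : min a T ≤ a := min_le_left _ _
    have hmT : min a T ≤ T := min_le_right _ _
    rcases hh with hh | hh
    · refine ⟨s + T - min a T / 2, ⟨by linarith, by linarith⟩, fun t ht => Or.inr ?_⟩
      by_contra hcon
      exact ht (hh _ (by linarith))
    · refine ⟨s + min a T / 2, ⟨by linarith, by linarith⟩, fun t ht => Or.inl ?_⟩
      by_contra hcon
      exact ht (hh _ (by linarith))
  let g : 𝓢(ℝ, ℝ) := SchwartzMap.compSubConstCLM ℝ t₀ h
  let f' : ℕ → 𝓢(ℝ, ℝ) := fun n => SchwartzMap.compSubConstCLM ℝ t₀ (f n)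
  have hg : ∀ ω, angularFourier g ω = Complex.exp (Complex.I * ω * t₀) * angularFourier h ω :=
    angularFourier_translate g h t₀ fun t => rfl
  have hf' : ∀ n ω, angularFourier (f' n) ω =
      Complex.exp (Complex.I * ω * t₀) * angularFourier (f n) ω :=
    fun n => angularFourier_translate (f' n) (f n) t₀ fun t => rfl
  -- Both functions are translated by `t₀`, so the phases cancel.
  have hprod : ∀ n ω, conj (angularFourier (f' n) ω) * angularFourier g ω =
      conj (angularFourier (f n) ω) * angularFourier h ω := by
    intro n ω
    have hE : conj (Complex.exp (Complex.I * ω * t₀)) * Complex.exp (Complex.I * ω * t₀) = 1 := by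
      rw [← Complex.exp_conj, ← Complex.exp_add]
      simp
    rw [hg, hf', map_mul]
    linear_combination (conj (angularFourier (f n) ω) * angularFourier h ω) * hE
  have hzero : ∀ᶠ n : ℕ in atTop,
      (∫ ω, conj (angularFourier (f n) ω) * angularFourier h ω ∂μ).im = 0 := by
    have h1 : ∀ᶠ n : ℕ in atTop, 1 / ((n : ℝ) + 1) < min (t₀ - s) (s + T - t₀) :=
      tendsto_one_div_add_atTop_nhds_zero_nat.eventually_lt_const
        (lt_min (by linarith [ht₀.1]) (by linarith [ht₀.2]))
    filter_upwards [h1] with n hn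
    have h2 := inner_im_eq_zero_of_duality μ s T hd (f' n) g ?_ ?_
    · rw [inner_oneParticle] at h2
      simpa only [hprod] using h2
    · intro t ht
      have h3 := hfs n (show f n (t - t₀) ≠ 0 from ht)
      rw [Metric.mem_ball, dist_zero_right, Real.norm_eq_abs, abs_lt] at h3
      have h4 := lt_min_iff.1 hn
      constructor <;> linarith
    · intro t ht
      exact hsupp t ht
  have hint : Integrable (fun ω => ‖angularFourier h ω‖) μ := by
    have h1 : angularFourier h = angularFourierCLM (complexify h) :=
      funext fun ω => angularFourier_eq h ω
    rw [h1]
    exact (SchwartzMap.integrable _).norm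
  have hlim : Tendsto (fun n => ∫ ω, conj (angularFourier (f n) ω) * angularFourier h ω ∂μ) atTop
      (𝓝 (∫ ω, angularFourier h ω ∂μ)) := by
    refine tendsto_integral_of_dominated_convergence _ (fun n => ?_) hint (fun n => ?_) ?_
    · exact (Complex.continuous_conj.comp_aestronglyMeasurable
        (memLp_angularFourier μ (f n)).aestronglyMeasurable).mul
        (memLp_angularFourier μ h).aestronglyMeasurable
    · refine Eventually.of_forall fun ω => ?_
      rw [norm_mul, RCLike.norm_conj]
      exact mul_le_of_le_one_left (norm_nonneg _) (hfb n ω)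
    · refine Eventually.of_forall fun ω => ?_
      have := ((Complex.continuous_conj.tendsto _).comp (hft ω)).mul_const (angularFourier h ω)
      simpa using! this
  exact tendsto_nhds_unique ((Complex.continuous_im.tendsto _).comp hlim)
    (tendsto_const_nhds.congr' (hzero.mono fun n hn => hn.symm))

/-! ### Tempered distributions supported at the origin -/

/-- Taylor bound for the derivatives of a function that vanishes to order `N` at the origin. -/
theorem norm_iteratedDeriv_le_of_vanishing (g : 𝓢(ℝ, ℂ)) (N : ℕ)
    (hg : ∀ j < N, iteratedDeriv j g 0 = 0) {C : ℝ} (hC : ∀ t, ‖iteratedDeriv N g t‖ ≤ C) :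
    ∀ m ≤ N, ∀ t, ‖iteratedDeriv (N - m) g t‖ ≤ C * |t| ^ m := by
  intro m
  induction m with
  | zero => intro _ t; simpa using hC t
  | succ m ih =>
    intro hm t
    have hC0 : 0 ≤ C := (norm_nonneg _).trans (hC 0)
    have hsucc : N - m = N - (m + 1) + 1 := by omega
    have hdiff : Differentiable ℝ (iteratedDeriv (N - (m + 1)) g) :=
      (g.smooth ⊤).differentiable_iteratedDeriv _ (WithTop.coe_lt_coe.2 (ENat.natCast_lt_top (N - (m + 1))))
    have hder : ∀ x, deriv (iteratedDeriv (N - (m + 1)) g) x = iteratedDeriv (N - m) g x := by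
      intro x; rw [hsucc, iteratedDeriv_succ]
    -- The mean value inequality on the ball of radius `|t|`, which contains `0` and `t`, gains one
    -- power of `|t|` for each order of derivative removed.
    have := (convex_closedBall (0 : ℝ) |t|).norm_image_sub_le_of_norm_deriv_le
      (f := iteratedDeriv (N - (m + 1)) g) (C := C * |t| ^ m) (x := 0) (y := t)
      (fun x _ => hdiff x) (fun x hx => by
        rw [hder]
        refine (ih (by omega) x).trans ?_
        have hx' : |x| ≤ |t| := by simpa using hx
        gcongr) (by simp) (by simp)
    rw [hg _ (by omega), sub_zero, sub_zero, Real.norm_eq_abs] at this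
    rw [pow_succ, ← mul_assoc]
    exact this

/-- A smooth cutoff, equal to one on `[-1, 1]` and zero outside `(-2, 2)`. -/
def cutoff : ContDiffBump (0 : ℝ) := ⟨1, 2, one_pos, one_lt_two⟩

theorem contDiff_cutoff_scaled (c : ℝ) : ContDiff ℝ (⊤ : ℕ∞) fun t => cutoff (c * t) :=
  cutoff.contDiff.comp (contDiff_const.mul contDiff_id)

theorem cutoff_scaled_eq_zero {ε t : ℝ} (hε : 0 < ε) (ht : 2 * ε ≤ |t|) : cutoff (ε⁻¹ * t) = 0 := by
  refine cutoff.zero_of_le_dist ?_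
  change 2 ≤ _
  rw [dist_zero_right, Real.norm_eq_abs, abs_mul, abs_of_pos (inv_pos.2 hε), inv_mul_eq_div,
    le_div_iff₀ hε]
  exact ht

theorem cutoff_scaled_eq_one {ε t : ℝ} (hε : 0 < ε) (ht : |t| ≤ ε) : cutoff (ε⁻¹ * t) = 1 := by
  refine cutoff.one_of_mem_closedBall ?_
  change _ ∈ Metric.closedBall _ (1 : ℝ)
  rw [mem_closedBall_zero_iff, Real.norm_eq_abs, abs_mul, abs_of_pos (inv_pos.2 hε), inv_mul_eq_div,
    div_le_iff₀ hε, one_mul]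
  exact ht

theorem hasTemperateGrowth_cutoff_scaled {ε : ℝ} (hε : 0 < ε) :
    (fun t => cutoff (ε⁻¹ * t)).HasTemperateGrowth := by
  refine HasCompactSupport.hasTemperateGrowth ?_ (contDiff_cutoff_scaled _)
  refine HasCompactSupport.intro (isCompact_closedBall (0 : ℝ) (2 * ε)) fun t ht => ?_
  refine cutoff_scaled_eq_zero hε ?_
  simpa using (not_le.1 (fun h => ht (mem_closedBall_zero_iff.2 h))).le

theorem exists_bound_iteratedDeriv_cutoff (l : ℕ) :
    ∃ M : ℝ, 0 ≤ M ∧ ∀ j ≤ l, ∀ t, ‖iteratedDeriv j cutoff t‖ ≤ M := by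
  have h1 : ∀ j : ℕ, ∃ M : ℝ, ∀ t, ‖iteratedDeriv j cutoff t‖ ≤ M := by
    intro j
    have hc : HasCompactSupport (iteratedDeriv j cutoff) := by
      refine HasCompactSupport.of_support_subset_isCompact cutoff.hasCompactSupport
        ?_
      intro t ht
      by_contra hcon
      apply ht
      have : (cutoff : ℝ → ℝ) =ᶠ[𝓝 t] fun _ => 0 := notMem_tsupport_iff_eventuallyEq.1 hcon
      rw [this.iteratedDeriv_eq]
      simp
    exact hc.exists_bound_of_continuous
      ((cutoff.contDiff (n := (⊤ : ℕ∞))).continuous_iteratedDeriv j (by exact_mod_cast le_top))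
  choose M hM using h1
  refine ⟨∑ j ∈ Finset.range (l + 1), |M j|, by positivity, fun j hj t => ?_⟩
  refine ((hM j t).trans (le_abs_self _)).trans ?_
  exact Finset.single_le_sum (f := fun j => |M j|) (fun _ _ => abs_nonneg _)
    (Finset.mem_range.2 (by omega))

/-- In the Leibniz rule, `i` derivatives on the cutoff cost `ε⁻ⁱ`, while on its support `|t| ≤ 2ε`
the Taylor bound makes the remaining derivative of order `l - i` of `g` as small as `ε^(N - l + i)`.
The net power is `ε^(N - l)`, at most `ε` because `l < N`. -/
theorem seminorm_cutoff_smul_le (g : 𝓢(ℝ, ℂ)) {N k l : ℕ} (hl : l < N)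
    (hg : ∀ j < N, iteratedDeriv j g 0 = 0) :
    ∃ K : ℝ, 0 ≤ K ∧ ∀ ε : ℝ, 0 < ε → ε ≤ 1 →
      SchwartzMap.seminorm ℂ k l (SchwartzMap.smulLeftCLM ℂ (fun t : ℝ => cutoff (ε⁻¹ * t)) g)
        ≤ K * ε := by
  obtain ⟨M, hM0, hM⟩ := exists_bound_iteratedDeriv_cutoff l
  set C : ℝ := SchwartzMap.seminorm ℂ 0 N g with hCdef
  have hC : ∀ t, ‖iteratedDeriv N g t‖ ≤ C := fun t => by
    simpa using SchwartzMap.le_seminorm' ℂ 0 N g t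
  have hC0 : 0 ≤ C := (norm_nonneg _).trans (hC 0)
  refine ⟨2 ^ k * ∑ i ∈ Finset.range (l + 1), (l.choose i : ℝ) * (M * (C * 2 ^ N)),
    by positivity, fun ε hε hε1 => ?_⟩
  refine SchwartzMap.seminorm_le_bound' ℂ k l _ (by positivity) fun t => ?_
  have hfun : ⇑(SchwartzMap.smulLeftCLM ℂ (fun t : ℝ => cutoff (ε⁻¹ * t)) g) =
      fun t => cutoff (ε⁻¹ * t) • g t :=
    SchwartzMap.smulLeftCLM_apply (hasTemperateGrowth_cutoff_scaled hε) g
  rw [hfun]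
  rcases lt_or_ge (2 * ε) |t| with ht | ht
  · have hz : (fun t => cutoff (ε⁻¹ * t) • g t) =ᶠ[𝓝 t] fun _ => 0 := by
      filter_upwards [continuous_abs.continuousAt.eventually_const_lt ht] with x hx
      rw [cutoff_scaled_eq_zero hε hx.le, zero_smul]
    rw [hz.iteratedDeriv_eq]
    simp
    positivity
  · have hχ : ∀ j ≤ l, ‖iteratedDeriv j (fun t => cutoff (ε⁻¹ * t)) t‖ ≤ ε⁻¹ ^ j * M := by
      intro j hj
      rw [iteratedDeriv_comp_const_mul cutoff.contDiff]
      simp only [norm_mul, norm_pow, Real.norm_eq_abs, abs_of_pos (inv_pos.2 hε)]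
      gcongr
      exact hM j hj _
    have hgt : ∀ i ≤ l, ‖iteratedDeriv i g t‖ ≤ C * (2 * ε) ^ (N - i) := by
      intro i hi
      have := norm_iteratedDeriv_le_of_vanishing g N hg hC (N - i) (by omega) t
      rw [show N - (N - i) = i by omega] at this
      refine this.trans ?_
      gcongr
    have hleib := norm_iteratedFDeriv_smul_le (contDiff_cutoff_scaled ε⁻¹) (g.smooth ⊤) t
      (n := l) (by exact_mod_cast le_top)
    simp only [norm_iteratedFDeriv_eq_norm_iteratedDeriv] at hleib
    have hterm : ∀ i ∈ Finset.range (l + 1),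
        (l.choose i : ℝ) * ‖iteratedDeriv i (fun t => cutoff (ε⁻¹ * t)) t‖ *
          ‖iteratedDeriv (l - i) g t‖ ≤ (l.choose i : ℝ) * (M * (C * 2 ^ N)) * ε := by
      intro i hi
      have hi' : i ≤ l := by simpa [Nat.lt_succ_iff] using hi
      have h1 := hχ i hi'
      have h2 := hgt (l - i) (by omega)
      have h3 : ε⁻¹ ^ i * ε ^ (N - (l - i)) ≤ ε := by
        have : N - (l - i) = i + (N - l - 1) + 1 := by omega
        rw [this, pow_succ, pow_add, ← mul_assoc, ← mul_assoc, ← mul_pow,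
          inv_mul_cancel₀ hε.ne', one_pow, one_mul]
        exact mul_le_of_le_one_left hε.le (pow_le_one₀ hε.le hε1)
      have h4 : (2 : ℝ) ^ (N - (l - i)) ≤ 2 ^ N := pow_le_pow_right₀ one_le_two (by omega)
      calc _ ≤ (l.choose i : ℝ) * (ε⁻¹ ^ i * M) * (C * (2 * ε) ^ (N - (l - i))) := by gcongr
        _ = (l.choose i : ℝ) * (M * (C * 2 ^ (N - (l - i)))) * (ε⁻¹ ^ i * ε ^ (N - (l - i))) := by
          rw [mul_pow]; ring
        _ ≤ _ := by gcongr
    have htk : |t| ^ k ≤ 2 ^ k := by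
      gcongr
      linarith
    calc _ ≤ 2 ^ k * ∑ i ∈ Finset.range (l + 1), (l.choose i : ℝ) * (M * (C * 2 ^ N)) * ε :=
          mul_le_mul htk (hleib.trans (Finset.sum_le_sum hterm)) (norm_nonneg _) (by positivity)
      _ = _ := by rw [← Finset.sum_mul]; ring

/-- The functional `g ↦ g⁽ᵏ⁾(0)`. -/
def derivAtZero (k : ℕ) : 𝓢(ℝ, ℂ) →ₗ[ℂ] ℂ where
  toFun g := iteratedDeriv k g 0
  map_add' f g := iteratedDeriv_add (f.smooth k).contDiffAt (g.smooth k).contDiffAt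
  map_smul' c g := by
    simp [iteratedDeriv_const_smul c (g.smooth k).contDiffAt]

/-- A tempered distribution supported at the origin is a finite combination of derivatives of the
delta function. -/
theorem exists_eq_sum_derivAtZero (Λ : 𝓢(ℝ, ℂ) →L[ℂ] ℂ)
    (hΛ : ∀ (h : 𝓢(ℝ, ℂ)) (ε : ℝ), 0 < ε → (∀ t, |t| ≤ ε → h t = 0) → Λ h = 0) :
    ∃ (N : ℕ) (c : Fin N → ℂ), ∀ g : 𝓢(ℝ, ℂ), Λ g = ∑ k, c k * iteratedDeriv k g 0 := by
  -- By continuity `Λ` is controlled by finitely many Schwartz seminorms; `N` exceeds every order of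
  -- derivative in them.
  obtain ⟨S, C, -, hS⟩ := Seminorm.bound_of_continuous (schwartz_withSeminorms ℂ ℝ ℂ)
    ((normSeminorm ℂ ℂ).comp Λ.toLinearMap) (by exact continuous_norm.comp Λ.continuous)
  set N : ℕ := S.sup Prod.snd + 1 with hN
  -- By linear algebra, a functional that vanishes on the common kernel of finitely many others is
  -- in their span.
  have hker : ⨅ k : Fin N, LinearMap.ker (derivAtZero k) ≤ LinearMap.ker Λ.toLinearMap := by
    intro g hg
    simp only [Submodule.mem_iInf, LinearMap.mem_ker] at hg
    have hg' : ∀ j < N, iteratedDeriv j g 0 = 0 := fun j hj => hg ⟨j, hj⟩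
    have hK : ∀ i ∈ S, ∃ K : ℝ, 0 ≤ K ∧ ∀ ε : ℝ, 0 < ε → ε ≤ 1 → SchwartzMap.seminorm ℂ i.1 i.2
        (SchwartzMap.smulLeftCLM ℂ (fun t : ℝ => cutoff (ε⁻¹ * t)) g) ≤ K * ε := fun i hi =>
      seminorm_cutoff_smul_le g (Nat.lt_succ_of_le (Finset.le_sup (f := Prod.snd) hi)) hg'
    choose! K hK0 hK using hK
    set K' : ℝ := ∑ i ∈ S, K i with hK'
    have hK'0 : 0 ≤ K' := Finset.sum_nonneg hK0
    have hbound : ∀ ε : ℝ, 0 < ε → ε ≤ 1 → ‖Λ g‖ ≤ C * K' * ε := by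
      intro ε hε hε1
      set gε := SchwartzMap.smulLeftCLM ℂ (fun t : ℝ => cutoff (ε⁻¹ * t)) g
      -- The difference vanishes near the origin, so `Λ g = Λ gε`, and the right side is `O(ε)`.
      have h1 : Λ (g - gε) = 0 := by
        refine hΛ _ ε hε fun t ht => ?_
        have : gε t = cutoff (ε⁻¹ * t) • g t :=
          SchwartzMap.smulLeftCLM_apply_apply (hasTemperateGrowth_cutoff_scaled hε) g t
        rw [sub_apply, this, cutoff_scaled_eq_one hε ht, one_smul, sub_self]
      rw [map_sub, sub_eq_zero] at h1
      rw [h1]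
      have h2 : ‖Λ gε‖ ≤ C * (S.sup (schwartzSeminormFamily ℂ ℝ ℂ)) gε := hS gε
      refine h2.trans ?_
      rw [mul_assoc]
      refine mul_le_mul_of_nonneg_left ?_ C.2
      refine Seminorm.finset_sup_apply_le (by positivity) fun i hi => ?_
      refine (hK i hi ε hε hε1).trans ?_
      gcongr
      exact Finset.single_le_sum hK0 hi
    have hlim : Tendsto (fun ε : ℝ => C * K' * ε) (𝓝[>] 0) (𝓝 0) := by
      have : Tendsto (fun ε : ℝ => C * K' * ε) (𝓝 0) (𝓝 (C * K' * 0)) :=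
        (continuous_const.mul continuous_id).tendsto 0
      rw [mul_zero] at this
      exact this.mono_left nhdsWithin_le_nhds
    have hev : ∀ᶠ ε : ℝ in 𝓝[>] 0, ‖Λ g‖ ≤ C * K' * ε := by
      filter_upwards [Ioc_mem_nhdsGT (zero_lt_one' ℝ)] with ε hε
      exact hbound ε hε.1 hε.2
    exact norm_le_zero_iff.1 (ge_of_tendsto hlim hev)
  have hspan := mem_span_of_iInf_ker_le_ker hker
  obtain ⟨c, hc⟩ := (Submodule.mem_span_range_iff_exists_fun ℂ).1 hspan
  refine ⟨N, c, fun g => ?_⟩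
  have := LinearMap.congr_fun hc g
  simpa [derivAtZero] using! this.symm

/-! ### The commutator distribution -/

/-- Reflection `G ↦ G(-·)` on Schwartz functions. -/
def reflectCLM : 𝓢(ℝ, ℂ) →L[ℂ] 𝓢(ℝ, ℂ) :=
  SchwartzMap.compCLMOfContinuousLinearEquiv ℂ (ContinuousLinearEquiv.neg ℝ)

/-- The commutator distribution `G ↦ ∫ (Ĝ(ω) - Ĝ(-ω)) dμ(ω)`. -/
def commutatorCLM (μ : Measure ℝ) [μ.HasTemperateGrowth] : 𝓢(ℝ, ℂ) →L[ℂ] ℂ :=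
  (SchwartzMap.integralCLM ℂ μ).comp
    ((ContinuousLinearMap.id ℂ _ - reflectCLM).comp angularFourierCLM)

theorem commutatorCLM_apply (μ : Measure ℝ) [μ.HasTemperateGrowth] (G : 𝓢(ℝ, ℂ)) :
    commutatorCLM μ G = ∫ ω, (angularFourierCLM G ω - angularFourierCLM G (-ω)) ∂μ := by
  simp only [commutatorCLM, ContinuousLinearMap.comp_apply, SchwartzMap.integralCLM_apply]
  rfl

/-- For real `h` the transform at `-ω` is the complex conjugate of that at `ω`, so the integrand is
`2i` times an imaginary part. This links the distribution to the symplectic form. -/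
theorem commutatorCLM_complexify (μ : Measure ℝ) [μ.HasTemperateGrowth] (h : 𝓢(ℝ, ℝ)) :
    commutatorCLM μ (complexify h) = 2 * (∫ ω, angularFourier h ω ∂μ).im * Complex.I := by
  have hint : Integrable (angularFourier h) μ := by
    rw [show angularFourier h = angularFourierCLM (complexify h) from
      funext fun ω => angularFourier_eq h ω]
    exact SchwartzMap.integrable _
  rw [commutatorCLM_apply]
  simp only [← angularFourier_eq, angularFourier_neg, Complex.sub_conj]
  rw [integral_mul_const]
  congr 1
  rw [integral_complex_ofReal, integral_const_mul]
  have := integral_im (𝕜 := ℂ) hint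
  simp only [RCLike.im_to_complex] at this
  rw [this]
  push_cast
  ring

theorem commutatorCLM_eq_zero_of_one_sided (μ : Measure ℝ) [μ.HasTemperateGrowth] (s T : ℝ)
    (hT : 0 < T) (hd : HaagDuality μ s T ∨ HaagDualityVN μ s T) {a : ℝ} (ha : 0 < a) (h : 𝓢(ℝ, ℂ))
    (hh : (∀ t ≤ a, h t = 0) ∨ ∀ t, -a ≤ t → h t = 0) : commutatorCLM μ h = 0 := by
  let r : 𝓢(ℝ, ℝ) := SchwartzMap.postcompCLM (𝕜 := ℝ) Complex.reCLM h
  let i : 𝓢(ℝ, ℝ) := SchwartzMap.postcompCLM (𝕜 := ℝ) Complex.imCLM h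
  have hdec : h = complexify r + Complex.I • complexify i := by
    ext t
    change h t = ((h t).re : ℂ) + Complex.I * ((h t).im : ℂ)
    rw [mul_comm, Complex.re_add_im]
  have hr : (∀ t ≤ a, r t = 0) ∨ ∀ t, -a ≤ t → r t = 0 := by
    refine hh.imp (fun H t ht => ?_) fun H t ht => ?_ <;>
    · change (h t).re = 0
      rw [H t ht, Complex.zero_re]
  have hi : (∀ t ≤ a, i t = 0) ∨ ∀ t, -a ≤ t → i t = 0 := by
    refine hh.imp (fun H t ht => ?_) fun H t ht => ?_ <;>
    · change (h t).im = 0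
      rw [H t ht, Complex.zero_im]
  rw [hdec, map_add, map_smul, commutatorCLM_complexify, commutatorCLM_complexify,
    integral_im_eq_zero_of_duality μ s T hT hd ha r hr,
    integral_im_eq_zero_of_duality μ s T hT hd ha i hi]
  simp

/-- The step is bounded and its derivative is supported in `[0, 1]`. Multiplication by it therefore
preserves Schwartz functions, which allows them to be split into past and future parts. -/
theorem hasTemperateGrowth_smoothTransition : Real.smoothTransition.HasTemperateGrowth := by
  have hsm : ContDiff ℝ (⊤ : ℕ∞) Real.smoothTransition := Real.smoothTransition.contDiff
  refine Function.HasTemperateGrowth.of_fderiv (k := 0) (C := 1) ?_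
    (hsm.differentiable (by simp)) fun x => ?_
  · refine HasCompactSupport.hasTemperateGrowth ?_ (hsm.fderiv_right (by simp))
    refine HasCompactSupport.intro (isCompact_Icc (a := (0 : ℝ)) (b := 1)) fun t ht => ?_
    rcases not_and_or.1 ht with h | h
    · have : Real.smoothTransition =ᶠ[𝓝 t] fun _ => 0 := by
        filter_upwards [Iio_mem_nhds (not_le.1 h)] with x hx
        exact Real.smoothTransition.zero_of_nonpos (le_of_lt hx)
      rw [this.fderiv_eq]; simp
    · have : Real.smoothTransition =ᶠ[𝓝 t] fun _ => 1 := by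
        filter_upwards [Ioi_mem_nhds (not_le.1 h)] with x hx
        exact Real.smoothTransition.one_of_one_le (le_of_lt hx)
      rw [this.fderiv_eq]; simp
  · simp [abs_of_nonneg (Real.smoothTransition.nonneg x), Real.smoothTransition.le_one x]

/-- Under duality, the commutator distribution is supported at the origin. -/
theorem commutatorCLM_eq_zero (μ : Measure ℝ) [μ.HasTemperateGrowth] (s T : ℝ)
    (hT : 0 < T) (hd : HaagDuality μ s T ∨ HaagDualityVN μ s T) (h : 𝓢(ℝ, ℂ)) (ε : ℝ) (hε : 0 < ε)
    (hh : ∀ t, |t| ≤ ε → h t = 0) : commutatorCLM μ h = 0 := by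
  -- The step rises within `[0, ε]`, where `h` vanishes, so `θh` is supported in `t ≥ ε` and `(1 -
  -- θ)h` in `t ≤ -ε`.
  let θ : ℝ → ℝ := fun t => Real.smoothTransition (ε⁻¹ * t)
  have hθ : θ.HasTemperateGrowth :=
    hasTemperateGrowth_smoothTransition.comp
      ((Function.HasTemperateGrowth.const ε⁻¹).mul Function.HasTemperateGrowth.id')
  let p : 𝓢(ℝ, ℂ) := SchwartzMap.smulLeftCLM ℂ θ h
  have hp : ∀ t, p t = θ t • h t := SchwartzMap.smulLeftCLM_apply_apply hθ h
  have h1 : commutatorCLM μ p = 0 := by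
    refine commutatorCLM_eq_zero_of_one_sided μ s T hT hd hε p (Or.inl fun t ht => ?_)
    rw [hp]
    rcases le_or_gt t 0 with h0 | h0
    · rw [show θ t = 0 from Real.smoothTransition.zero_of_nonpos
        (mul_nonpos_of_nonneg_of_nonpos (inv_nonneg.2 hε.le) h0), zero_smul]
    · rw [hh t (by rw [abs_of_pos h0]; exact ht), smul_zero]
  have h2 : commutatorCLM μ (h - p) = 0 := by
    refine commutatorCLM_eq_zero_of_one_sided μ s T hT hd hε (h - p) (Or.inr fun t ht => ?_)
    rw [sub_apply, hp]
    rcases le_or_gt ε t with h0 | h0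
    · rw [show θ t = 1 from Real.smoothTransition.one_of_one_le
        (by rw [inv_mul_eq_div, one_le_div hε]; exact h0), one_smul, sub_self]
    · rw [hh t (abs_le.2 ⟨ht, h0.le⟩), smul_zero, sub_zero]
  rw [map_sub, h1, sub_zero] at h2
  exact h2

/-! ### The polynomial density -/

theorem iteratedDeriv_fourier_zero (Φ : 𝓢(ℝ, ℂ)) (k : ℕ) :
    iteratedDeriv k (FourierTransform.fourier Φ : 𝓢(ℝ, ℂ)) 0 =
      ∫ x : ℝ, (-2 * Real.pi * Complex.I * x) ^ k * Φ x := by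
  rw [SchwartzMap.fourier_coe, Real.iteratedDeriv_fourier (N := ⊤) (fun n _ => ?_) le_top,
    Real.fourier_eq']
  · simp
  · refine ((SchwartzMap.integrable_pow_mul volume Φ n).mono' ?_ (Eventually.of_forall fun x => ?_))
    · have := Φ.continuous
      exact (by fun_prop : Continuous fun x : ℝ => x ^ n • Φ x).aestronglyMeasurable
    · simp

/-- Under duality, `μ` integrates test functions on `(0, ∞)` like a polynomial density. -/
theorem exists_polynomial_density (μ : Measure ℝ) [μ.HasTemperateGrowth] (hμ : μ (Set.Iic 0) = 0)
    (s T : ℝ) (hT : 0 < T) (hd : HaagDuality μ s T ∨ HaagDualityVN μ s T) :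
    ∃ (N : ℕ) (b : Fin N → ℝ), ∀ ψ : ℝ → ℝ, ContDiff ℝ (⊤ : ℕ∞) ψ → HasCompactSupport ψ →
      tsupport ψ ⊆ Set.Ioi 0 → ∫ ω, ψ ω ∂μ = ∫ ω, ψ ω * ∑ k, b k * ω ^ (k : ℕ) := by
  obtain ⟨N, c, hc⟩ := exists_eq_sum_derivAtZero (commutatorCLM μ)
    (commutatorCLM_eq_zero μ s T hT hd)
  -- The factor `(-i)ᵏ` comes from differentiating the Fourier kernel and `(2π)⁻¹` from the
  -- substitution `ω = 2πx`. Real parts suffice because both `∫ ψ dμ` and the moments of `ψ` are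
  -- real.
  refine ⟨N, fun k => (c k * ((2 * Real.pi)⁻¹ * (-Complex.I) ^ (k : ℕ))).re, fun ψ hψ hψc hψs => ?_⟩
  have hpi : (0 : ℝ) < 2 * Real.pi := by positivity
  let ψC : 𝓢(ℝ, ℂ) := complexify (hψc.toSchwartzMap hψ)
  -- `Φ` is `ψ` in Mathlib's frequency. By Fourier inversion its transform `G` is the test function
  -- whose angular transform is `ψ`.
  let Φ : 𝓢(ℝ, ℂ) := reflectCLM
    (SchwartzMap.compCLMOfContinuousLinearEquiv ℂ angularScale.symm ψC)
  have hscale : ∀ x, angularScale.symm (-x) = 2 * Real.pi * x := by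
    intro x
    rw [ContinuousLinearEquiv.symm_apply_eq, angularScale_apply]
    field_simp
  have hΦ : ∀ x, Φ x = ψ (2 * Real.pi * x) := by
    intro x
    change ((ψ (angularScale.symm (-x)) : ℝ) : ℂ) = _
    rw [hscale]
  let G : 𝓢(ℝ, ℂ) := FourierTransform.fourier Φ
  have hG : ∀ ω, angularFourierCLM G ω = ψ ω := by
    intro ω
    have h1 : FourierTransformInv.fourierInv (FourierTransform.fourier Φ) = Φ :=
      FourierTransform.fourierInv_fourier_eq Φ
    have h2 := DFunLike.congr_fun h1 ((2 * Real.pi)⁻¹ * ω)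
    rw [hΦ, mul_inv_cancel_left₀ hpi.ne'] at h2
    rw [← h2, angularFourierCLM_apply, angularScale_apply, neg_mul]
    rfl
  have hL : commutatorCLM μ G = ((∫ ω, ψ ω ∂μ : ℝ) : ℂ) := by
    rw [commutatorCLM_apply, ← integral_complex_ofReal]
    refine integral_congr_ae ?_
    have hpos : ∀ᵐ ω ∂μ, ω ∉ Set.Iic (0 : ℝ) := measure_eq_zero_iff_ae_notMem.1 hμ
    filter_upwards [hpos] with ω hω
    -- The reflected term drops out, since `ψ` is supported in `(0, ∞)` and `ω > 0` almost
    -- everywhere.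
    have : ψ (-ω) = 0 := by
      by_contra hne
      have := hψs (subset_tsupport _ hne)
      simp only [Set.mem_Ioi, Set.mem_Iic, not_le] at this hω
      linarith
    rw [hG, hG, this, Complex.ofReal_zero, sub_zero]
  have hmom : ∀ k : ℕ, iteratedDeriv k G 0 =
      (2 * Real.pi)⁻¹ * (-Complex.I) ^ k * ((∫ ω, ψ ω * ω ^ k : ℝ) : ℂ) := by
    intro k
    rw [iteratedDeriv_fourier_zero]
    have := Measure.integral_comp_mul_left
      (fun x : ℝ => (-Complex.I * x) ^ k * (ψ x : ℂ)) (2 * Real.pi)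
    rw [abs_of_pos (inv_pos.2 hpi)] at this
    calc _ = ∫ x : ℝ, (-Complex.I * ((2 * Real.pi * x : ℝ) : ℂ)) ^ k * (ψ (2 * Real.pi * x) : ℂ) := by
          congr 1
          funext x
          rw [hΦ]
          congr 2
          push_cast
          ring
      _ = _ := by
          rw [this, ← integral_complex_ofReal, mul_assoc, ← integral_const_mul, Complex.real_smul]
          push_cast
          congr 2
          funext x
          ring
  have hfin := hc G
  rw [hL] at hfin
  have hint : ∀ k : ℕ, Integrable fun ω => ψ ω * ω ^ k := fun k =>
    (hψ.continuous.mul (continuous_pow k)).integrable_of_hasCompactSupport hψc.mul_right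
  have hre := congrArg Complex.re hfin
  rw [Complex.ofReal_re, Complex.re_sum] at hre
  rw [hre]
  simp only [Finset.mul_sum]
  rw [integral_finsetSum]
  · refine Finset.sum_congr rfl fun k _ => ?_
    rw [hmom, ← mul_assoc, Complex.re_mul_ofReal, ← integral_const_mul]
    congr 1
    funext ω
    ring
  · intro k _
    refine ((hint k).const_mul
      (c k * ((2 * Real.pi)⁻¹ * (-Complex.I) ^ (k : ℕ))).re).congr (Eventually.of_forall fun ω => ?_)
    simp only
    ring

/-! ### From test functions to measures -/

/-- A bump function equal to one on the unit ball around a point is Schwartz, hence `μ`-integrable.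
-/
theorem isLocallyFiniteMeasure_of_tempered (μ : Measure ℝ) [μ.HasTemperateGrowth] :
    IsLocallyFiniteMeasure μ := by
  refine ⟨fun x => ⟨Metric.ball x 1, Metric.ball_mem_nhds x one_pos, ?_⟩⟩
  have hφ := ((⟨1, 2, one_pos, one_lt_two⟩ : ContDiffBump x).hasCompactSupport.toSchwartzMap
    (⟨1, 2, one_pos, one_lt_two⟩ : ContDiffBump x).contDiff).integrable (μ := μ)
  refine lt_of_le_of_lt (measure_mono fun y hy => ?_) (hφ.measure_ge_lt_top one_pos)
  exact ((⟨1, 2, one_pos, one_lt_two⟩ : ContDiffBump x).one_of_mem_closedBall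
    (Metric.ball_subset_closedBall hy)).ge

/-- A locally finite measure that integrates test functions on `(0, ∞)` like the continuous density
`p` is `p dω` there, and `p` is non-negative. -/
theorem restrict_eq_withDensity_of_integral_eq (μ : Measure ℝ) [IsLocallyFiniteMeasure μ]
    {p : ℝ → ℝ} (hp : Continuous p)
    (h : ∀ ψ : ℝ → ℝ, ContDiff ℝ (⊤ : ℕ∞) ψ → HasCompactSupport ψ → tsupport ψ ⊆ Set.Ioi 0 →
      ∫ ω, ψ ω ∂μ = ∫ ω, ψ ω * p ω) :
    μ.restrict (Set.Ioi 0) =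
        (volume.restrict (Set.Ioi 0)).withDensity (fun ω => ENNReal.ofReal (p ω)) ∧
      ∀ᵐ ω ∂(volume.restrict (Set.Ioi (0 : ℝ))), 0 ≤ p ω := by
  -- Absolute continuity of `μ` is not yet known, so `μ` and Lebesgue measure are compared through
  -- their densities `A, B ≤ 1` with respect to the sum. Testing against smooth functions then
  -- yields `A = B p` almost everywhere on `(0, ∞)`.
  set l : Measure ℝ := μ + volume with hl
  have : IsLocallyFiniteMeasure l := ⟨fun x => by
    obtain ⟨u, hu, hμu⟩ := μ.finiteAt_nhds x
    obtain ⟨v, hv, hvv⟩ := (volume : Measure ℝ).finiteAt_nhds x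
    refine ⟨u ∩ v, Filter.inter_mem hu hv, ?_⟩
    rw [hl, Measure.add_apply]
    exact ENNReal.add_lt_top.2 ⟨(measure_mono Set.inter_subset_left).trans_lt hμu,
      (measure_mono Set.inter_subset_right).trans_lt hvv⟩⟩
  have hμl : μ ≪ l := (Measure.le_add_right le_rfl).absolutelyContinuous
  have hvl : (volume : Measure ℝ) ≪ l := (Measure.le_add_left le_rfl).absolutelyContinuous
  have hA1 : μ.rnDeriv l ≤ᵐ[l] 1 := Measure.rnDeriv_le_one_of_le (Measure.le_add_right le_rfl)
  have hB1 : (volume : Measure ℝ).rnDeriv l ≤ᵐ[l] 1 :=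
    Measure.rnDeriv_le_one_of_le (Measure.le_add_left le_rfl)
  set A := μ.rnDeriv l
  set B := (volume : Measure ℝ).rnDeriv l
  have hAm : Measurable A := Measure.measurable_rnDeriv _ _
  have hBm : Measurable B := Measure.measurable_rnDeriv _ _
  have key : ∀ᵐ x ∂l, x ∈ Set.Ioi (0 : ℝ) → (A x).toReal - (B x).toReal * p x = 0 := by
    refine isOpen_Ioi.ae_eq_zero_of_integral_contDiff_smul_eq_zero ?_ fun ψ hψ hψc hψs => ?_
    · refine LocallyIntegrable.locallyIntegrableOn ?_ _
      have h1 : LocallyIntegrable (fun x => (A x).toReal) l := by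
        refine (locallyIntegrable_const (1 : ℝ)).mono hAm.ennreal_toReal.aestronglyMeasurable ?_
        filter_upwards [hA1] with x hx
        simpa using ENNReal.toReal_mono ENNReal.one_ne_top hx
      have h2 : LocallyIntegrable (fun x => (B x).toReal * p x) l := by
        refine hp.locallyIntegrable.mono
          (hBm.ennreal_toReal.mul hp.measurable).aestronglyMeasurable ?_
        filter_upwards [hB1] with x hx
        have : (B x).toReal ≤ 1 := by simpa using ENNReal.toReal_mono ENNReal.one_ne_top hx
        rw [norm_mul, Real.norm_of_nonneg ENNReal.toReal_nonneg]
        exact mul_le_of_le_one_left (norm_nonneg _) this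
      exact h1.sub h2
    · have hi1 : Integrable ψ μ := hψ.continuous.integrable_of_hasCompactSupport hψc
      have hi2 : Integrable (fun x => ψ x * p x) :=
        (hψ.continuous.mul hp).integrable_of_hasCompactSupport hψc.mul_right
      have e1 := integral_rnDeriv_smul (f := ψ) hμl
      have e2 := integral_rnDeriv_smul (f := fun x => ψ x * p x) hvl
      have j1 := (integrable_rnDeriv_smul_iff (f := ψ) hμl).2 hi1
      have j2 := (integrable_rnDeriv_smul_iff (f := fun x => ψ x * p x) hvl).2 hi2
      calc _ = ∫ x, ((A x).toReal • ψ x - (B x).toReal • (ψ x * p x)) ∂l := by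
            congr 1; funext x; simp only [smul_eq_mul]; ring
        _ = 0 := by rw [integral_sub j1 j2, e1, e2, h ψ hψ hψc hψs, sub_self]
  constructor
  · have hμ' : l.withDensity A = μ := Measure.withDensity_rnDeriv_eq _ _ hμl
    have hv' : l.withDensity B = volume := Measure.withDensity_rnDeriv_eq _ _ hvl
    rw [← hμ', ← hv', restrict_withDensity measurableSet_Ioi,
      restrict_withDensity measurableSet_Ioi,
      ← withDensity_mul _ hBm hp.measurable.ennreal_ofReal]
    refine withDensity_congr_ae ?_
    have hkey := (ae_restrict_iff' measurableSet_Ioi).2 key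
    filter_upwards [hkey, ae_restrict_of_ae hA1, ae_restrict_of_ae hB1] with x h1 h2 h3
    have h2' : A x ≠ ⊤ := ne_top_of_le_ne_top ENNReal.one_ne_top h2
    have h3' : B x ≠ ⊤ := ne_top_of_le_ne_top ENNReal.one_ne_top h3
    rw [← ENNReal.ofReal_toReal h2', sub_eq_zero.1 h1, ENNReal.ofReal_mul ENNReal.toReal_nonneg,
      ENNReal.ofReal_toReal h3', Pi.mul_apply]
  · rw [ae_restrict_iff' measurableSet_Ioi]
    -- Lebesgue-almost everywhere `B > 0`, so `p` inherits its sign from `A ≥ 0`.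
    filter_upwards [hvl.ae_le key, Measure.rnDeriv_pos hvl, hvl.ae_le hB1] with x h1 h2 h3 hx
    have h3' : B x ≠ ⊤ := ne_top_of_le_ne_top ENNReal.one_ne_top h3
    have h4 : 0 < (B x).toReal := ENNReal.toReal_pos h2.ne' h3'
    have h5 := sub_eq_zero.1 (h1 hx)
    refine nonneg_of_mul_nonneg_right (b := p x) (a := (B x).toReal) ?_ h4
    rw [← h5]
    exact ENNReal.toReal_nonneg

/-- Polynomials are entire of every positive exponential type. -/
theorem norm_polynomial_lt_exp {N : ℕ} (b : Fin N → ℝ) {T : ℝ} (hT : 0 < T) :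
    ∃ C : ℝ, ∀ z : ℂ, ‖∑ k, (b k : ℂ) * z ^ (k : ℕ)‖ < C * Real.exp (T * ‖z‖) := by
  -- The weights come from `(T‖z‖)ᵏ / k! ≤ e^{T‖z‖}`; the extra `1` makes the inequality strict.
  refine ⟨∑ k, |b k| * ((k : ℕ).factorial / T ^ (k : ℕ)) + 1, fun z => ?_⟩
  rw [add_mul, one_mul, Finset.sum_mul]
  refine lt_add_of_le_of_pos ((norm_sum_le _ _).trans (Finset.sum_le_sum fun k _ => ?_))
    (Real.exp_pos _)
  have h1 := Real.pow_div_factorial_le_exp (T * ‖z‖) (by positivity) k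
  rw [norm_mul, norm_pow, Complex.norm_real, Real.norm_eq_abs, mul_assoc]
  refine mul_le_mul_of_nonneg_left ?_ (abs_nonneg _)
  calc ‖z‖ ^ (k : ℕ) = (k : ℕ).factorial / T ^ (k : ℕ) *
        ((T * ‖z‖) ^ (k : ℕ) / (k : ℕ).factorial) := by
        rw [mul_pow]; field_simp
    _ ≤ _ := by gcongr

end GFF
end

/-! ### The main theorem -/

theorem mainTheorem12 (μ : MeasureTheory.Measure ℝ) [μ.HasTemperateGrowth]
    (hμ : μ (Set.Iic 0) = 0) (s T : ℝ) (hT : 0 < T)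
    (h : GFF.HaagDuality μ s T ∨ GFF.HaagDualityVN μ s T) :
    ∃ F : ℂ → ℂ, Differentiable ℂ F ∧
      (∃ C : ℝ, ∀ z : ℂ, ‖F z‖ < C * Real.exp (T * ‖z‖)) ∧
      (∃ ρ : ℝ → ℝ, GFF.IsSpectralDensity μ ρ) ∧
      ∀ ρ : ℝ → ℝ, GFF.IsSpectralDensity μ ρ →
        ∀ᵐ ω ∂(MeasureTheory.volume.restrict (Set.Ioi (0 : ℝ))), (ρ (ω ^ 2) : ℂ) = F ω := by
  obtain ⟨N, b, hb⟩ := GFF.exists_polynomial_density μ hμ s T hT h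
  have := GFF.isLocallyFiniteMeasure_of_tempered μ
  let p : ℝ → ℝ := fun ω => ∑ k, b k * ω ^ (k : ℕ)
  have hp : Continuous p := by fun_prop
  obtain ⟨hμp, hp0⟩ := GFF.restrict_eq_withDensity_of_integral_eq μ hp hb
  have hμr : μ.restrict (Set.Ioi 0) = μ := by
    refine Measure.restrict_eq_self_of_ae_mem ?_
    filter_upwards [measure_eq_zero_iff_ae_notMem.1 hμ] with ω hω
    simpa using hω
  rw [hμr] at hμp
  refine ⟨fun z => ∑ k, (b k : ℂ) * z ^ (k : ℕ), by fun_prop, GFF.norm_polynomial_lt_exp b hT,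
    -- The square root converts the variable `ω²` back to `ω`. The truncation makes the density
    -- non-negative everywhere and is invisible to `ENNReal.ofReal`.
    ⟨fun x => max (p (Real.sqrt x)) 0, ?_, fun x _ => le_max_right _ _, ?_⟩, ?_⟩
  · exact ((hp.comp Real.continuous_sqrt).max continuous_const).measurable
  · refine hμp.trans (withDensity_congr_ae ?_)
    filter_upwards [ae_restrict_mem measurableSet_Ioi] with ω hω
    rw [Real.sqrt_sq (le_of_lt hω), ENNReal.ofReal_max, ENNReal.ofReal_zero, max_eq_left zero_le]
  · rintro ρ ⟨hρm, hρ0, hρ⟩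
    -- Densities are unique up to null sets, and `ENNReal.ofReal` is injective on the non-negative
    -- values involved.
    have heq := (withDensity_eq_iff_of_sigmaFinite
      (hρm.comp (measurable_id.pow_const 2)).ennreal_ofReal.aemeasurable
      hp.measurable.ennreal_ofReal.aemeasurable).1 (hρ.symm.trans hμp)
    filter_upwards [heq, hp0, ae_restrict_mem measurableSet_Ioi] with ω h1 h2 h3
    have h4 : ρ (ω ^ 2) = p ω :=
      (ENNReal.ofReal_eq_ofReal_iff (hρ0 _ (pow_pos h3 2)) h2).1 h1
    rw [h4]
    simp [p]
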